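/- Fix a vocabulary $\tau$ consisting of finitely many relation symbols of finite arity. The Gaifman graph $\mathsf{Gaif}(M)$ of a $\tau$-structure $M$ is the graph on the domain of $M$ in which two distinct elements are adjacent if and only if they occur together in some tuple of some relation of $M$. For $S\subseteq M$ write $\mathsf{Gaif}(M)\setminus S$ for the graph obtained from $\mathsf{Gaif}(M)$ by deleting the vertices in $S$. A set of vertices of a graph is $r$-independent if any two distinct elements of it are at distance greater than $r$ (the distance between different components being infinite). For $S\subseteq M$ and $n\ge 1$, the $n$-fold free amalgam $\oplus^n_S M = M\oplus_S\cdots\oplus_S M$ is the quotient of the disjoint union of $n$ copies of $M$ obtained by identifying, for every $s\in S$, all the copies of $s$; its relations are the images of the relations of the disjoint union. Let $\mathcal C$ be a class of finite $\tau$-structures that is closed under isomorphisms and hereditary, i.e. closed under induced substructures (if the empty structure is admitted as a structure, it suffices that $\mathcal C$ is closed under isomorphic copies of nonempty induced substructures). Suppose that for every $r\in\mathbb N$ there exist $k_r\in\mathbb N$ and $f_r:\mathbb N\to\mathbb N$ such that for every $m\in\mathbb N$ and every $M\in\mathcal C$ with $|M|\ge f_r(m)$ there exist disjoint sets $A,S\subseteq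 M$ with 1. $|A|\ge m$ and $|S|\le k_r$; 2. $A$ is $r$-independent in $\mathsf{Gaif}(M)\setminus S$; 3. $\oplus^n_S M\in\mathcal C$ for every $n\ge 1$. Then $\mathcal C$ has the homomorphism preservation property: for every first-order $\tau$-sentence $\varphi$ such that $A\models\varphi$ implies $B\models\varphi$ whenever $A,B\in\mathcal C$ and there is a homomorphism $A\to B$, there is an existential-positive $\tau$-sentence $\psi$ (built from $\bot$, $\top$, equalities and relational atoms by conjunction, disjunction and existential quantification) such that $M\models\varphi\iff M\models\psi$ for all $M\in\mathcal C$. -/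

import Mathlib

open FirstOrder CategoryTheory

universe u v w

namespace HomPreservation

open FirstOrder.Language FirstOrder.Language.Structure

/-- A formula is existential-positive if it is built from `⊥`, `⊤`, equalities and relational atoms
by conjunction, disjunction and existential quantification. -/
inductive IsExistentialPositive {L : FirstOrder.Language.{u, v}} {α : Type w} :
    ∀ {n : ℕ}, L.BoundedFormula α n → Prop
  | falsum {n : ℕ} : IsExistentialPositive (⊥ : L.BoundedFormula α n)
  | verum {n : ℕ} : IsExistentialPositive (⊤ : L.BoundedFormula α n)
  | equal {n : ℕ} (t₁ t₂ : L.Term (α ⊕ Fin n)) : IsExistentialPositive (t₁.bdEqual t₂)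
  | rel {n k : ℕ} (R : L.Relations k) (ts : Fin k → L.Term (α ⊕ Fin n)) :
      IsExistentialPositive (R.boundedFormula ts)
  | and {n : ℕ} {φ ψ : L.BoundedFormula α n} (hφ : IsExistentialPositive φ)
      (hψ : IsExistentialPositive ψ) : IsExistentialPositive (φ ⊓ ψ)
  | or {n : ℕ} {φ ψ : L.BoundedFormula α n} (hφ : IsExistentialPositive φ)
      (hψ : IsExistentialPositive ψ) : IsExistentialPositive (φ ⊔ ψ)
  | ex {n : ℕ} {φ : L.BoundedFormula α (n + 1)} (hφ : IsExistentialPositive φ) :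
      IsExistentialPositive φ.ex

/-- The sentence `φ` is preserved by homomorphisms over the class `C`. -/
def PreservedByHoms {L : FirstOrder.Language.{u, v}} (C : Set (Bundled.{w} L.Structure))
    (φ : L.Sentence) : Prop :=
  ∀ A ∈ C, ∀ B ∈ C, Nonempty (A →[L] B) → A ⊨ φ → B ⊨ φ

/-- The homomorphism preservation property of a class of structures. -/
def HasHomPreservation {L : FirstOrder.Language.{u, v}} (C : Set (Bundled.{w} L.Structure)) :
    Prop :=
  ∀ φ : L.Sentence, PreservedByHoms C φ →
    ∃ ψ : L.Sentence, IsExistentialPositive ψ ∧ ∀ M ∈ C, (M ⊨ φ ↔ M ⊨ ψ)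

/-- Closure under (isomorphic copies of) nonempty induced substructures. Nonemptiness is required
so that the notion makes sense both when the empty structure is admitted and when structures are
nonempty by convention; closure under all induced substructures is a stronger property. -/
def IsHereditary {L : FirstOrder.Language.{u, v}} (C : Set (Bundled.{w} L.Structure)) : Prop :=
  ∀ M ∈ C, ∀ N : Bundled.{w} L.Structure, Nonempty N → Nonempty (N ↪[L] M) → N ∈ C

/-- The Gaifman graph: two distinct elements are adjacent iff they appear together in some tuple of
some relation. -/
def gaifmanGraph (L : FirstOrder.Language.{u, v}) (M : Type w) [L.Structure M] : SimpleGraph M where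
  Adj a b := a ≠ b ∧ ∃ (k : ℕ) (R : L.Relations k) (x : Fin k → M),
    RelMap R x ∧ a ∈ Set.range x ∧ b ∈ Set.range x
  symm := ⟨fun _ _ ⟨hne, k, R, x, hR, ha, hb⟩ => ⟨hne.symm, k, R, x, hR, hb, ha⟩⟩
  loopless := ⟨fun _ h => h.1 rfl⟩

/-- The ball of radius `r` around `a` (the distance is `⊤` between different components). -/
def graphBall {V : Type w} (G : SimpleGraph V) (r : ℕ) (a : V) : Set V :=
  {b | G.edist a b ≤ r}

/-- A set of vertices is `r`-independent if its elements are pairwise at distance more than `r`. -/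
def IsIndependent {V : Type w} (G : SimpleGraph V) (r : ℕ) (A : Set V) : Prop :=
  ∀ a ∈ A, ∀ b ∈ A, a ≠ b → b ∉ graphBall G r a

/-- The elements of `A` (outside of `S`) form an `r`-independent set after the elements of `S` are
deleted, i.e. in the graph obtained from the Gaifman graph of `M` by deleting the vertices in `S`.
If all relations have arity at most two, this graph is the Gaifman graph of the substructure
of `M` induced on the complement of `S`. -/
def IndependentAfterDeleting (L : FirstOrder.Language.{u, v}) (M : Type w) [L.Structure M] (r : ℕ)
    (A S : Set M) : Prop :=
  IsIndependent ((gaifmanGraph L M).induce Sᶜ) r (Subtype.val ⁻¹' A)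

/-- The equivalence relation on the disjoint union `Fin n × M` of `n` copies of `M` which
identifies, for each `s ∈ S`, all the copies of `s`. -/
def amalgamSetoid {M : Type w} (S : Set M) (n : ℕ) : Setoid (Fin n × M) where
  r p q := p = q ∨ (p.2 = q.2 ∧ p.2 ∈ S)
  iseqv :=
    { refl := fun _ => Or.inl rfl
      symm := by
        rintro p q (h | ⟨h, hs⟩)
        · exact Or.inl h.symm
        · exact Or.inr ⟨h.symm, h ▸ hs⟩
      trans := by
        rintro p q t (rfl | ⟨h, hs⟩) (rfl | ⟨h', hs'⟩)
        · exact Or.inl rfl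
        · exact Or.inr ⟨h', hs'⟩
        · exact Or.inr ⟨h, hs⟩
        · exact Or.inr ⟨h.trans h', hs⟩ }

/-- The domain of the `n`-fold free amalgam `M ⊕_S M ⊕_S ⋯ ⊕_S M` of `M` over `S`. -/
def FreeAmalgam {M : Type w} (S : Set M) (n : ℕ) : Type w :=
  Quotient (amalgamSetoid S n)

/-- The quotient map from the disjoint union of `n` copies of `M` onto the free amalgam:
`FreeAmalgam.mk S n i a` is the element represented by the element `a` of the `i`-th copy. -/
def FreeAmalgam.mk {M : Type w} (S : Set M) (n : ℕ) (i : Fin n) (a : M) : FreeAmalgam S n :=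
  Quotient.mk (amalgamSetoid S n) (i, a)

/-- The relations of the free amalgam are the images of the relations of the disjoint union of
the copies of `M`, i.e. every related tuple comes from a related tuple of a single copy. -/
instance FreeAmalgam.instStructure {L : FirstOrder.Language.{u, v}} [L.IsRelational] {M : Type w}
    [L.Structure M] (S : Set M) (n : ℕ) : L.Structure (FreeAmalgam S n) where
  funMap f := isEmptyElim f
  RelMap R x := ∃ (i : Fin n) (a : Fin _ → M), RelMap R a ∧ x = fun j => FreeAmalgam.mk S n i (a j)

/-- The `n`-fold free amalgam `M ⊕_S M ⊕_S ⋯ ⊕_S M` as a (bundled) structure. -/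
def amalgam {L : FirstOrder.Language.{u, v}} [L.IsRelational] (M : Bundled.{w} L.Structure)
    (S : Set M) (n : ℕ) : Bundled.{w} L.Structure :=
  ⟨FreeAmalgam S n, FreeAmalgam.instStructure S n⟩

end HomPreservation

/-!
Let `φ` be preserved by homomorphisms over `C`, and let `q` be its quantifier rank. The point is
that a large model `M ∈ C` of `φ` always has an element `a` such that `M` without `a` is still a
model of `φ` (`exists_removeElement_models`). Since `C` is hereditary, it follows that every model
in `C` contains a model in `C` of bounded size, and then `φ` is equivalent to the finite
disjunction of the canonical existential-positive sentences of the models of bounded size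
(`exists_isExistentialPositive_of_bounded`).

For the key step, let `A` and `S` be as in the hypothesis for `r = 2 ^ (q + 1)`, name the elements
of `S` by constants, and let distances be measured after `S` is deleted. Let `X` be the amalgam of
`q + 1` copies of `M` over `S` from which `a` is removed in all copies but one, and let `Y` be the
same amalgam with `a` removed in all copies. Both are induced substructures of the amalgam, hence
in `C`, and there are homomorphisms `M → X` and `Y → M ∖ {a}`. So it is enough that `X` and `Y`
satisfy the same sentences of quantifier rank `q`.

This is a locality argument in the style of Hanf and Gaifman, carried out with games rather than
with local formulas. The local type of rank `j` of a tuple (`localType`) describes the game in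
which, with `i` rounds left to be played afterwards, one may only choose elements at distance at
most `2 ^ i` from the elements chosen before. It depends only on the balls of radius `2 ^ j`
around the tuple (`localType_comp`), there are finitely many local types (`finite_localType`), and
winning positions that are far apart can be merged (`LocallyEquiv.union`). Consequently, in the
unrestricted game between `X` and `Y`, a move close to the elements chosen before is answered as
in the local game, while for any other move it suffices to find an element of the same local type
in a fresh copy (`realize_sentence_iff`, `hasFarRealizations_puncturedAmalgam`).

Such an element exists if every local type realized in `M ∖ S` has a realization whose ball of
radius `2 ^ q` does not contain `a`. As `A` is `r`-independent, each such ball contains at most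
one element of `A`, so this holds for some `a ∈ A` once `A` has more elements than there are local
types (`exists_far_from_types`).
-/

namespace HomPreservation

open FirstOrder.Language FirstOrder.Language.Structure

/-! ### Distances in graphs -/

section Graph

variable {V : Type*} {V' : Type*} {G : SimpleGraph V} {G' : SimpleGraph V'}

theorem eq_or_exists_adj_of_edist_le {d : ℕ} {x y : V} (h : G.edist x y ≤ (d + 1 : ℕ)) :
    x = y ∨ ∃ z, G.Adj x z ∧ G.edist z y ≤ d := by
  obtain ⟨p, hp⟩ := SimpleGraph.exists_walk_of_edist_ne_top
    (ne_top_of_le_ne_top (ENat.natCast_ne_top _) h)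
  cases p with
  | nil => exact Or.inl rfl
  | cons hadj p =>
    refine Or.inr ⟨_, hadj, p.edist_le.trans ?_⟩
    rw [← hp, SimpleGraph.Walk.length_cons] at h
    have h' := Nat.cast_le.1 h
    exact_mod_cast (by omega : p.length ≤ d)

theorem edist_le_succ_of_adj {d : ℕ} {x y z : V} (h : G.Adj x y) (hd : G.edist y z ≤ d) :
    G.edist x z ≤ (d + 1 : ℕ) :=
  calc G.edist x z ≤ G.edist x y + G.edist y z := SimpleGraph.edist_triangle
    _ ≤ 1 + d := add_le_add (SimpleGraph.edist_eq_one_iff_adj.2 h).le hd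
    _ = (d + 1 : ℕ) := by push_cast; exact add_comm _ _

theorem edist_le_add {d e : ℕ} {x y z : V} (h : G.edist x y ≤ d) (h' : G.edist y z ≤ e) :
    G.edist x z ≤ (d + e : ℕ) := by
  push_cast
  exact SimpleGraph.edist_triangle.trans (add_le_add h h')

theorem mem_of_edist_le {T : Set V} (hT : ∀ x ∈ T, ∀ y, G.Adj x y → y ∈ T) {d : ℕ} {x y : V}
    (hx : x ∈ T) (h : G.edist x y ≤ d) : y ∈ T := by
  induction d generalizing x with
  | zero =>
    have : x = y := by simpa using h
    exact this ▸ hx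
  | succ d ih =>
    rcases eq_or_exists_adj_of_edist_le h with rfl | ⟨z, hz, h⟩
    · exact hx
    · exact ih (hT _ hx _ hz) h

theorem edist_map_le {f : V → V'} (hf : ∀ x y, G.Adj x y → G'.Adj (f x) (f y)) {d : ℕ} {x y : V}
    (h : G.edist x y ≤ d) : G'.edist (f x) (f y) ≤ d := by
  induction d generalizing x with
  | zero =>
    have : x = y := by simpa using h
    simp [this]
  | succ d ih =>
    rcases eq_or_exists_adj_of_edist_le h with rfl | ⟨z, hz, h⟩
    · simp
    · exact edist_le_succ_of_adj (hf _ _ hz) (ih h)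

/-- Paths of length at most `d` starting at `f x` lift along `f`, provided that edges lift at
those vertices all of whose neighbours lie in the range of `f`, and that the ball of radius `d`
around `f x` lies in the range of `f`. -/
theorem exists_edist_le_of_ball_subset_range {f : V → V'}
    (hf : ∀ x, (∀ y, G'.Adj (f x) y → y ∈ Set.range f) →
      ∀ y, G'.Adj (f x) y → ∃ z, f z = y ∧ G.Adj x z)
    {d : ℕ} {x : V} {y : V'} (hball : ∀ z, G'.edist (f x) z ≤ d → z ∈ Set.range f)
    (h : G'.edist (f x) y ≤ d) : ∃ z, f z = y ∧ G.edist x z ≤ d := by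
  induction d generalizing x with
  | zero =>
    have : f x = y := by simpa using h
    exact ⟨x, this, by simp⟩
  | succ d ih =>
    rcases eq_or_exists_adj_of_edist_le h with rfl | ⟨z, hz, h⟩
    · exact ⟨x, rfl, by simp⟩
    · obtain ⟨z, rfl, hxz⟩ := hf x (fun y hy => hball y
        ((SimpleGraph.edist_eq_one_iff_adj.2 hy).le.trans (by push_cast; simp))) z hz
      obtain ⟨y, rfl, hy⟩ := ih (fun y hy => hball y (edist_le_succ_of_adj hz hy)) h
      exact ⟨y, rfl, edist_le_succ_of_adj hxz hy⟩

end Graph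

/-! ### Local types -/

section LocalType

variable {L : FirstOrder.Language.{u, v}} {ι : Type}

/-- The Gaifman graph in which the elements named by the constants `s` have been isolated. (It has
the same distances between the remaining elements as the graph obtained by deleting the elements
named by `s`.) -/
def isolatedGraph (L : FirstOrder.Language.{u, v}) {X : Type w} [L.Structure X] (s : ι → X) :
    SimpleGraph X where
  Adj x y := (gaifmanGraph L X).Adj x y ∧ x ∉ Set.range s ∧ y ∉ Set.range s
  symm := ⟨fun _ _ ⟨h, hx, hy⟩ => ⟨h.symm, hy, hx⟩⟩
  loopless := ⟨fun x h => (gaifmanGraph L X).loopless.irrefl x h.1⟩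

/-- The possible atomic types of an `n`-tuple over constants indexed by `ι`: a set of equalities,
a set of relational atoms, and a set of pairs of entries together with bounds `d ≤ r` on their
distance. -/
abbrev AtomicType (L : FirstOrder.Language.{u, v}) (ι : Type) (r n : ℕ) : Type v :=
  Set ((ι ⊕ Fin n) × (ι ⊕ Fin n)) × Set (Σ R : (Σ k, L.Relations k), (Fin R.1 → ι ⊕ Fin n)) ×
    Set (Fin n × Fin n × Fin (r + 1))

/-- The possible local types of rank `j` of an `n`-tuple over constants indexed by `ι`. -/
def LocalType (L : FirstOrder.Language.{u, v}) (ι : Type) : ℕ → ℕ → Type v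
  | 0, n => AtomicType L ι 1 n
  | j + 1, n => AtomicType L ι (2 ^ (j + 1)) n × Set (LocalType L ι j (n + 1))

theorem finite_localType [Finite L.Symbols] [Finite ι] (j n : ℕ) :
    Finite (LocalType L ι j n) := by
  have : Finite (Σ k, L.Relations k) :=
    Finite.of_injective (Sum.inr : _ → L.Symbols) Sum.inr_injective
  induction j generalizing n with
  | zero => exact inferInstanceAs (Finite (AtomicType L ι 1 n))
  | succ j ih =>
    have := ih (n + 1)
    exact inferInstanceAs
      (Finite (AtomicType L ι (2 ^ (j + 1)) n × Set (LocalType L ι j (n + 1))))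

/-- The atomic type of a tuple `a` over the constants `s`, with a record of the distances up to
`r`, measured after the constants are deleted. -/
def atomicType {X : Type w} [L.Structure X] (s : ι → X) (r : ℕ) {n : ℕ} (a : Fin n → X) :
    AtomicType L ι r n :=
  ({z | Sum.elim s a z.1 = Sum.elim s a z.2}, {R | RelMap R.1.2 fun i => Sum.elim s a (R.2 i)},
    {z | (isolatedGraph L s).edist (a z.1) (a z.2.1) ≤ (z.2.2 : ℕ)})

/-- The local type of rank `j` of a tuple `a` over the constants `s`: the atomic type of `a` with
distances up to `2 ^ j`, together with, if `j = j' + 1`, the local types of rank `j'` of the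
extensions of `a` by an element at distance at most `2 ^ j'` from `a`, after the constants are
deleted. -/
def localType {X : Type w} [L.Structure X] (s : ι → X) :
    ∀ (j : ℕ) {n : ℕ} (_ : Fin n → X), LocalType L ι j n
  | 0, _, a => atomicType s 1 a
  | j + 1, n, a => (atomicType s (2 ^ (j + 1)) a,
      {t | ∃ c, (∃ i, (isolatedGraph L s).edist (a i) c ≤ (2 ^ j : ℕ)) ∧
        localType s j (Fin.snoc a c : Fin (n + 1) → X) = t})

theorem atomicType_eq_of_localType_eq {X Y : Type w} [L.Structure X] [L.Structure Y] {s : ι → X}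
    {t : ι → Y} {j n : ℕ} {a : Fin n → X} {b : Fin n → Y}
    (h : localType (L := L) s j a = localType t j b) :
    atomicType (L := L) s (2 ^ j) a = atomicType t (2 ^ j) b := by
  cases j with
  | zero => exact h
  | succ j => exact congrArg Prod.fst h

theorem isolatedGraph_adj_map {X Y : Type w} [L.Structure X] [L.Structure Y] (f : X ↪[L] Y)
    (s : ι → X) {x y : X} (h : (isolatedGraph L s).Adj x y) :
    (isolatedGraph L (f ∘ s)).Adj (f x) (f y) := by
  obtain ⟨⟨hne, k, R, z, hR, ⟨i, rfl⟩, ⟨i', rfl⟩⟩, hx, hy⟩ := h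
  refine ⟨⟨fun h => hne (f.injective h), k, R, f ∘ z, (f.map_rel R z).2 hR, ⟨i, rfl⟩, ⟨i', rfl⟩⟩,
    ?_, ?_⟩
  · rintro ⟨k, hk⟩
    exact hx ⟨k, f.injective hk⟩
  · rintro ⟨k, hk⟩
    exact hy ⟨k, f.injective hk⟩

theorem exists_isolatedGraph_adj {X Y : Type w} [L.Structure X] [L.Structure Y] (f : X ↪[L] Y)
    (s : ι → X) {x : X} (hx : ∀ y, (isolatedGraph L (f ∘ s)).Adj (f x) y → y ∈ Set.range f) {y : Y}
    (h : (isolatedGraph L (f ∘ s)).Adj (f x) y) : ∃ z, f z = y ∧ (isolatedGraph L s).Adj x z := by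
  obtain ⟨⟨hne, k, R, z, hR, ⟨i, hi⟩, ⟨i', rfl⟩⟩, hxs, hys⟩ := h
  -- The whole tuple `z` lies in the range of `f`: its entries are constants, or `f x`,
  -- or neighbours of `f x`.
  have hz : ∀ l, ∃ z', f z' = z l := by
    intro l
    by_cases hl : z l ∈ Set.range (f ∘ s)
    · obtain ⟨m, hm⟩ := hl
      exact ⟨s m, hm⟩
    · by_cases hlx : f x = z l
      · exact ⟨x, hlx⟩
      · exact hx _ ⟨⟨hlx, k, R, z, hR, ⟨i, hi⟩, ⟨l, rfl⟩⟩, hxs, hl⟩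
  choose z' hz' using hz
  obtain rfl : f ∘ z' = z := funext hz'
  refine ⟨z' i', rfl, ⟨fun h => hne (by simp [h]), k, R, z', (f.map_rel R z').1 hR,
    ⟨i, f.injective hi⟩, ⟨i', rfl⟩⟩, ?_, ?_⟩
  · rintro ⟨m, rfl⟩
    exact hxs ⟨m, rfl⟩
  · rintro ⟨m, hm⟩
    exact hys ⟨m, congrArg f hm⟩

theorem edist_le_iff_of_ball_subset_range {X Y : Type w} [L.Structure X] [L.Structure Y]
    (f : X ↪[L] Y) (s : ι → X) {d : ℕ} {x y : X}
    (hball : ∀ z, (isolatedGraph L (f ∘ s)).edist (f x) z ≤ d → z ∈ Set.range f) :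
    (isolatedGraph L (f ∘ s)).edist (f x) (f y) ≤ d ↔ (isolatedGraph L s).edist x y ≤ d := by
  refine ⟨fun h => ?_, edist_map_le fun _ _ => isolatedGraph_adj_map f s⟩
  obtain ⟨z, hz, h⟩ := exists_edist_le_of_ball_subset_range (f := f)
    (fun x hx y => exists_isolatedGraph_adj f s hx) hball h
  rwa [f.injective hz] at h

theorem atomicType_comp {X Y : Type w} [L.Structure X] [L.Structure Y] (f : X ↪[L] Y) (s : ι → X)
    (r : ℕ) {n : ℕ} (a : Fin n → X)
    (hball : ∀ i y, (isolatedGraph L (f ∘ s)).edist (f (a i)) y ≤ r → y ∈ Set.range f) :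
    atomicType (L := L) (f ∘ s) r (f ∘ a) = atomicType s r a := by
  have h : Sum.elim (f ∘ s) (f ∘ a) = f ∘ Sum.elim s a := by
    ext z; cases z <;> rfl
  refine Prod.ext (Set.ext fun z => ?_) (Prod.ext (Set.ext fun R => ?_) (Set.ext fun z => ?_))
  · simp [atomicType, h]
  · simp only [atomicType, h, Set.mem_ofPred_eq]
    exact f.map_rel R.1.2 _
  · exact edist_le_iff_of_ball_subset_range f s fun y hy =>
      hball _ y (hy.trans (by exact_mod_cast Nat.le_of_lt_succ z.2.2.2))

/-- An embedding preserves the local type of a tuple of rank `j` if its range contains the balls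
of radius `2 ^ j` around the tuple. -/
theorem localType_comp {X Y : Type w} [L.Structure X] [L.Structure Y] (f : X ↪[L] Y) (s : ι → X)
    (j : ℕ) {n : ℕ} (a : Fin n → X)
    (hball : ∀ i y, (isolatedGraph L (f ∘ s)).edist (f (a i)) y ≤ (2 ^ j : ℕ) → y ∈ Set.range f) :
    localType (L := L) (f ∘ s) j (f ∘ a) = localType s j a := by
  induction j generalizing n with
  | zero => exact atomicType_comp f s _ a hball
  | succ j ih =>
    have hsnoc : ∀ c i, (isolatedGraph L s).edist (a i) c ≤ (2 ^ j : ℕ) →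
        localType (L := L) (f ∘ s) j (Fin.snoc (f ∘ a) (f c) : Fin (n + 1) → Y) =
          localType s j (Fin.snoc a c : Fin (n + 1) → X) := by
      intro c i hc
      rw [← Fin.comp_snoc]
      refine ih _ fun i' y hy => ?_
      induction i' using Fin.lastCases with
      | last =>
        rw [Fin.snoc_last] at hy
        refine hball i y ?_
        rw [pow_succ, mul_two]
        exact edist_le_add (edist_map_le (fun _ _ => isolatedGraph_adj_map f s) hc) hy
      | cast i' =>
        rw [Fin.snoc_castSucc] at hy
        exact hball i' y (hy.trans (by exact_mod_cast Nat.pow_le_pow_right two_pos j.le_succ))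
    refine Prod.ext (atomicType_comp f s _ a hball) (Set.ext fun t => ⟨?_, ?_⟩)
    · rintro ⟨c, ⟨i, hi⟩, rfl⟩
      obtain ⟨c, rfl, hc⟩ := exists_edist_le_of_ball_subset_range (f := f)
        (fun x hx y => exists_isolatedGraph_adj f s hx)
        (fun z hz => hball i z
          (hz.trans (by exact_mod_cast Nat.pow_le_pow_right two_pos j.le_succ))) hi
      exact ⟨c, ⟨i, hc⟩, (hsnoc c i hc).symm⟩
    · rintro ⟨c, ⟨i, hi⟩, rfl⟩
      exact ⟨f c, ⟨i, edist_map_le (fun _ _ => isolatedGraph_adj_map f s) hi⟩, hsnoc c i hi⟩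

end LocalType

/-! ### The local back-and-forth game -/

section Game

variable {L : FirstOrder.Language.{u, v}} {ι : Type} {X Y : Type w} [L.Structure X] [L.Structure Y]
  {s : ι → X} {t : ι → Y}

/-- The pairs of elements of two structures which are named by the same constant. -/
def constantPairs (s : ι → X) (t : ι → Y) : Set (X × Y) :=
  Set.range fun i => (s i, t i)

/-- The set `P` of pairs, together with the pairs of constants, is the graph of a partial
isomorphism, and `P` preserves the distances up to `r`, measured after the constants are
deleted. -/
def IsPartialIso (L : FirstOrder.Language.{u, v}) {X Y : Type w} [L.Structure X] [L.Structure Y]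
    (s : ι → X) (t : ι → Y) (r : ℕ) (P : Set (X × Y)) : Prop :=
  (∀ p ∈ P ∪ constantPairs s t, ∀ p' ∈ P ∪ constantPairs s t, p.1 = p'.1 ↔ p.2 = p'.2) ∧
  (∀ (k : ℕ) (R : L.Relations k) (x : Fin k → X × Y), (∀ i, x i ∈ P ∪ constantPairs s t) →
    (RelMap R (fun i => (x i).1) ↔ RelMap R fun i => (x i).2)) ∧
  ∀ p ∈ P, ∀ p' ∈ P, ∀ d : ℕ, d ≤ r →
    ((isolatedGraph L s).edist p.1 p'.1 ≤ d ↔ (isolatedGraph L t).edist p.2 p'.2 ≤ d)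

/-- Duplicator wins the `j`-round local back-and-forth game from the position `P`, in which the
element chosen by Spoiler has to be at distance at most `2 ^ i` from an element of the position if
`i` rounds remain to be played afterwards, and positions have to preserve the distances up to
`2 ^ i` if `i` rounds remain to be played. -/
def LocallyEquiv (L : FirstOrder.Language.{u, v}) {X Y : Type w} [L.Structure X] [L.Structure Y]
    (s : ι → X) (t : ι → Y) : ℕ → Set (X × Y) → Prop
  | 0, P => IsPartialIso L s t 1 P
  | j + 1, P => IsPartialIso L s t (2 ^ (j + 1)) P ∧
      (∀ c, (∃ p ∈ P, (isolatedGraph L s).edist p.1 c ≤ (2 ^ j : ℕ)) →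
        ∃ d, LocallyEquiv L s t j (insert (c, d) P)) ∧
      ∀ d, (∃ p ∈ P, (isolatedGraph L t).edist p.2 d ≤ (2 ^ j : ℕ)) →
        ∃ c, LocallyEquiv L s t j (insert (c, d) P)

theorem LocallyEquiv.isPartialIso {j : ℕ} {P : Set (X × Y)} (h : LocallyEquiv L s t j P) :
    IsPartialIso L s t (2 ^ j) P := by
  cases j with
  | zero => exact h
  | succ j => exact h.1

theorem IsPartialIso.mono {r r' : ℕ} (hr : r ≤ r') {P : Set (X × Y)}
    (h : IsPartialIso L s t r' P) : IsPartialIso L s t r P :=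
  ⟨h.1, h.2.1, fun p hp p' hp' d hd => h.2.2 p hp p' hp' d (hd.trans hr)⟩

/-- Distances are part of positions precisely in order that the number of rounds can be lowered:
Duplicator's answers then stay as close to the position as Spoiler's choices. -/
theorem LocallyEquiv.of_succ {j : ℕ} {P : Set (X × Y)} (h : LocallyEquiv L s t (j + 1) P) :
    LocallyEquiv L s t j P := by
  induction j generalizing P with
  | zero => exact h.1.mono one_le_two
  | succ j ih =>
    have hle : ((2 ^ j : ℕ) : ℕ∞) ≤ (2 ^ (j + 1) : ℕ) := by
      exact_mod_cast Nat.pow_le_pow_right two_pos j.le_succ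
    refine ⟨h.1.mono (Nat.pow_le_pow_right two_pos (j + 1).le_succ), ?_, ?_⟩
    · rintro c ⟨p, hp, hc⟩
      obtain ⟨d, hd⟩ := h.2.1 c ⟨p, hp, hc.trans hle⟩
      exact ⟨d, ih hd⟩
    · rintro d ⟨p, hp, hd⟩
      obtain ⟨c, hc⟩ := h.2.2 d ⟨p, hp, hd.trans hle⟩
      exact ⟨c, ih hc⟩

theorem range_prodMk_snoc {n : ℕ} (a : Fin n → X) (b : Fin n → Y) (c : X) (d : Y) :
    (Set.range fun i => ((Fin.snoc a c : Fin (n + 1) → X) i, (Fin.snoc b d : Fin (n + 1) → Y) i)) =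
      insert (c, d) (Set.range fun i => (a i, b i)) := by
  rw [← Fin.range_snoc]
  congr 1
  ext i : 1
  induction i using Fin.lastCases <;> simp

theorem isPartialIso_of_atomicType_eq {r n : ℕ} {a : Fin n → X} {b : Fin n → Y}
    (h : atomicType (L := L) s r a = atomicType t r b) :
    IsPartialIso L s t r (Set.range fun i => (a i, b i)) := by
  have hmem : ∀ p ∈ (Set.range fun i => (a i, b i)) ∪ constantPairs s t,
      ∃ z, p = (Sum.elim s a z, Sum.elim t b z) := by
    rintro p (⟨i, rfl⟩ | ⟨i, rfl⟩)
    · exact ⟨Sum.inr i, rfl⟩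
    · exact ⟨Sum.inl i, rfl⟩
  refine ⟨?_, ?_, ?_⟩
  · intro p hp p' hp'
    obtain ⟨z, rfl⟩ := hmem p hp
    obtain ⟨z', rfl⟩ := hmem p' hp'
    exact Set.ext_iff.1 (congrArg Prod.fst h) (z, z')
  · intro k R x hx
    choose z hz using fun i => hmem (x i) (hx i)
    simp only [hz]
    exact Set.ext_iff.1 (congrArg (fun T => T.2.1) h) ⟨⟨k, R⟩, z⟩
  · rintro _ ⟨i, rfl⟩ _ ⟨i', rfl⟩ d hd
    exact Set.ext_iff.1 (congrArg (fun T => T.2.2) h) (i, i', ⟨d, Nat.lt_succ_of_le hd⟩)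

/-- Tuples of the same local type form a winning position. -/
theorem locallyEquiv_of_localType_eq {j n : ℕ} {a : Fin n → X} {b : Fin n → Y}
    (h : localType (L := L) s j a = localType t j b) :
    LocallyEquiv L s t j (Set.range fun i => (a i, b i)) := by
  induction j generalizing n with
  | zero => exact isPartialIso_of_atomicType_eq h
  | succ j ih =>
    have hset := Set.ext_iff.1 (congrArg Prod.snd h)
    refine ⟨isPartialIso_of_atomicType_eq (atomicType_eq_of_localType_eq h), ?_, ?_⟩
    · rintro c ⟨_, ⟨i, rfl⟩, hc⟩
      obtain ⟨d, -, heq⟩ := (hset _).1 ⟨c, ⟨i, hc⟩, rfl⟩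
      refine ⟨d, ?_⟩
      rw [← range_prodMk_snoc]
      exact ih heq.symm
    · rintro d ⟨_, ⟨i, rfl⟩, hd⟩
      obtain ⟨c, -, heq⟩ := (hset _).2 ⟨d, ⟨i, hd⟩, rfl⟩
      refine ⟨c, ?_⟩
      rw [← range_prodMk_snoc]
      exact ih heq

theorem eq_of_edist_constant_le {i : ι} {c : X} {d : ℕ}
    (h : (isolatedGraph L s).edist (s i) c ≤ d) : s i = c :=
  (mem_of_edist_le (G := isolatedGraph L s) (T := {s i})
    (fun _ hx _ hxy => absurd ⟨i, Eq.symm hx⟩ hxy.2.1) rfl h).symm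

theorem edist_constant_le_iff {i : ι} {c : X} {d : ℕ} :
    (isolatedGraph L s).edist (s i) c ≤ d ↔ s i = c :=
  ⟨eq_of_edist_constant_le, fun h => by simp [h]⟩

theorem locallyEquiv_of_subset_constantPairs (h : IsPartialIso L s t 0 ∅) (j : ℕ)
    {P : Set (X × Y)} (hP : P ⊆ constantPairs s t) : LocallyEquiv L s t j P := by
  have hiso : ∀ r, IsPartialIso L s t r P := by
    intro r
    have hu : P ∪ constantPairs s t = ∅ ∪ constantPairs s t := by
      rw [Set.union_eq_self_of_subset_left hP, Set.empty_union]
    refine ⟨hu ▸ h.1, hu ▸ h.2.1, fun p hp p' hp' d _ => ?_⟩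
    have hpp' := h.1 p (Or.inr (hP hp)) p' (Or.inr (hP hp'))
    obtain ⟨i, rfl⟩ := hP hp
    rw [edist_constant_le_iff, edist_constant_le_iff]
    exact hpp'
  induction j generalizing P with
  | zero => exact hiso 1
  | succ j ih =>
    refine ⟨hiso _, ?_, ?_⟩
    · rintro c ⟨p, hp, hc⟩
      obtain ⟨i, rfl⟩ := hP hp
      obtain rfl := eq_of_edist_constant_le hc
      exact ⟨t i, by rw [Set.insert_eq_of_mem hp]; exact ih hP hiso⟩
    · rintro d ⟨p, hp, hd⟩
      obtain ⟨i, rfl⟩ := hP hp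
      obtain rfl := eq_of_edist_constant_le hd
      exact ⟨s i, by rw [Set.insert_eq_of_mem hp]; exact ih hP hiso⟩

/-- Two positions are `d`-separated if in both structures their elements are at distance more than
`d`, after the constants are deleted. -/
def Separated (L : FirstOrder.Language.{u, v}) {X Y : Type w} [L.Structure X] [L.Structure Y]
    (s : ι → X) (t : ι → Y) (d : ℕ) (P Q : Set (X × Y)) : Prop :=
  ∀ p ∈ P, ∀ q ∈ Q,
    ¬ (isolatedGraph L s).edist p.1 q.1 ≤ d ∧ ¬ (isolatedGraph L t).edist p.2 q.2 ≤ d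

theorem Separated.symm {d : ℕ} {P Q : Set (X × Y)} (h : Separated L s t d P Q) :
    Separated L s t d Q P := by
  intro q hq p hp
  rw [SimpleGraph.edist_comm, SimpleGraph.edist_comm (u := q.2)]
  exact h p hp q hq

theorem Separated.insert_left {d : ℕ} {P Q : Set (X × Y)} (h : Separated L s t (d + d) P Q)
    {c : X × Y} (hX : ∃ p ∈ P, (isolatedGraph L s).edist p.1 c.1 ≤ d)
    (hY : ∃ p ∈ P, (isolatedGraph L t).edist p.2 c.2 ≤ d) :
    Separated L s t d (insert c P) Q := by
  rintro p (rfl | hp) q hq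
  · obtain ⟨p₁, hp₁, h₁⟩ := hX
    obtain ⟨p₂, hp₂, h₂⟩ := hY
    exact ⟨fun hd => (h p₁ hp₁ q hq).1 (edist_le_add h₁ hd),
      fun hd => (h p₂ hp₂ q hq).2 (edist_le_add h₂ hd)⟩
  · have hle : (d : ℕ∞) ≤ (d + d : ℕ) := by exact_mod_cast Nat.le_add_left d d
    exact ⟨fun hd => (h p hp q hq).1 (hd.trans hle), fun hd => (h p hp q hq).2 (hd.trans hle)⟩

theorem IsPartialIso.union {r : ℕ} (hr : 1 ≤ r) {P Q : Set (X × Y)} (hP : IsPartialIso L s t r P)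
    (hQ : IsPartialIso L s t r Q) (hPQ : Separated L s t r P Q) :
    IsPartialIso L s t r (P ∪ Q) := by
  have hr' : (1 : ℕ∞) ≤ r := by exact_mod_cast hr
  have hne : ∀ p ∈ P, ∀ q ∈ Q, p.1 ≠ q.1 ∧ p.2 ≠ q.2 := fun p hp q hq =>
    ⟨fun h => (hPQ p hp q hq).1 (by simp [h]), fun h => (hPQ p hp q hq).2 (by simp [h])⟩
  have hfar : ∀ p ∈ P, ∀ q ∈ Q, ∀ d : ℕ, d ≤ r →
      ((isolatedGraph L s).edist p.1 q.1 ≤ d ↔ (isolatedGraph L t).edist p.2 q.2 ≤ d) := by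
    intro p hp q hq d hd
    have hd' : (d : ℕ∞) ≤ r := by exact_mod_cast hd
    exact iff_of_false (fun h => (hPQ p hp q hq).1 (h.trans hd'))
      fun h => (hPQ p hp q hq).2 (h.trans hd')
  have hcases : ∀ p ∈ P ∪ Q ∪ constantPairs s t, ∀ p' ∈ P ∪ Q ∪ constantPairs s t,
      (p ∈ P ∪ constantPairs s t ∧ p' ∈ P ∪ constantPairs s t) ∨
      (p ∈ Q ∪ constantPairs s t ∧ p' ∈ Q ∪ constantPairs s t) ∨
      (p ∈ P ∧ p' ∈ Q) ∨ (p ∈ Q ∧ p' ∈ P) := by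
    intro p hp p' hp'
    simp only [Set.mem_union] at *
    tauto
  -- A tuple with entries from both positions satisfies no relation, as these entries
  -- would be adjacent.
  have hsplit : ∀ (k : ℕ) (R : L.Relations k) (x : Fin k → X × Y),
      (∀ i, x i ∈ P ∪ Q ∪ constantPairs s t) →
      (RelMap R (fun i => (x i).1) ∨ RelMap R fun i => (x i).2) →
      (∀ i, x i ∈ P ∪ constantPairs s t) ∨ ∀ i, x i ∈ Q ∪ constantPairs s t := by
    intro k R x hx hR
    by_contra! hcon
    obtain ⟨⟨i, hi⟩, ⟨i', hi'⟩⟩ := hcon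
    have hiQ : x i ∈ Q := by
      have := hx i; simp only [Set.mem_union] at *; tauto
    have hiP : x i' ∈ P := by
      have := hx i'; simp only [Set.mem_union] at *; tauto
    have hconst₁ : ∀ (W : Set (X × Y)), IsPartialIso L s t r W → ∀ p ∈ W,
        p ∉ constantPairs s t → p.1 ∉ Set.range s ∧ p.2 ∉ Set.range t := by
      intro W hW p hp hps
      constructor
      · rintro ⟨m, hm⟩
        exact hps ⟨m, Prod.ext hm ((hW.1 (s m, t m) (Or.inr ⟨m, rfl⟩) p (Or.inl hp)).1 hm)⟩
      · rintro ⟨m, hm⟩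
        exact hps ⟨m, Prod.ext ((hW.1 (s m, t m) (Or.inr ⟨m, rfl⟩) p (Or.inl hp)).2 hm) hm⟩
    have h₁ := hconst₁ P hP _ hiP fun h => hi' (Or.inr h)
    have h₂ := hconst₁ Q hQ _ hiQ fun h => hi (Or.inr h)
    have hn := hne _ hiP _ hiQ
    rcases hR with hR | hR
    · refine (hPQ _ hiP _ hiQ).1 ((SimpleGraph.edist_eq_one_iff_adj.2 ?_).le.trans hr')
      exact ⟨⟨hn.1, k, R, _, hR, ⟨i', rfl⟩, ⟨i, rfl⟩⟩, h₁.1, h₂.1⟩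
    · refine (hPQ _ hiP _ hiQ).2 ((SimpleGraph.edist_eq_one_iff_adj.2 ?_).le.trans hr')
      exact ⟨⟨hn.2, k, R, _, hR, ⟨i', rfl⟩, ⟨i, rfl⟩⟩, h₁.2, h₂.2⟩
  refine ⟨?_, ?_, ?_⟩
  · intro p hp p' hp'
    rcases hcases p hp p' hp' with h | h | h | h
    · exact hP.1 p h.1 p' h.2
    · exact hQ.1 p h.1 p' h.2
    · exact iff_of_false (hne p h.1 p' h.2).1 (hne p h.1 p' h.2).2
    · exact iff_of_false (hne p' h.2 p h.1).1.symm (hne p' h.2 p h.1).2.symm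
  · intro k R x hx
    constructor
    · intro hR
      rcases hsplit k R x hx (Or.inl hR) with h | h
      · exact (hP.2.1 k R x h).1 hR
      · exact (hQ.2.1 k R x h).1 hR
    · intro hR
      rcases hsplit k R x hx (Or.inr hR) with h | h
      · exact (hP.2.1 k R x h).2 hR
      · exact (hQ.2.1 k R x h).2 hR
  · rintro p (hp | hp) p' (hp' | hp') d hd
    · exact hP.2.2 p hp p' hp' d hd
    · exact hfar p hp p' hp' d hd
    · rw [SimpleGraph.edist_comm, SimpleGraph.edist_comm (u := p.2)]
      exact hfar p' hp' p hp d hd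
    · exact hQ.2.2 p hp p' hp' d hd

/-- Winning positions which are far apart can be merged, because a local move near one of them
does not interfere with the other. -/
theorem LocallyEquiv.union {j : ℕ} {P Q : Set (X × Y)} (hP : LocallyEquiv L s t j P)
    (hQ : LocallyEquiv L s t j Q) (hPQ : Separated L s t (2 ^ j) P Q) :
    LocallyEquiv L s t j (P ∪ Q) := by
  induction j generalizing P Q with
  | zero => exact IsPartialIso.union le_rfl hP hQ hPQ
  | succ j ih =>
    have hd : 2 ^ (j + 1) = 2 ^ j + 2 ^ j := by rw [pow_succ, mul_two]
    have hstep : ∀ {P Q : Set (X × Y)} {z : X × Y}, LocallyEquiv L s t (j + 1) Q →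
        Separated L s t (2 ^ (j + 1)) P Q →
        ((∃ p ∈ P, (isolatedGraph L s).edist p.1 z.1 ≤ (2 ^ j : ℕ)) ∨
          ∃ p ∈ P, (isolatedGraph L t).edist p.2 z.2 ≤ (2 ^ j : ℕ)) →
        LocallyEquiv L s t j (insert z P) → LocallyEquiv L s t j (insert z (P ∪ Q)) := by
      intro P Q z hQ hPQ hnear hP
      rw [← Set.insert_union]
      rw [hd] at hPQ
      have hiff := fun p (hp : p ∈ P) => hP.isPartialIso.2.2 p (Or.inr hp) z (Or.inl rfl) _ le_rfl
      refine ih hP hQ.of_succ (hPQ.insert_left ?_ ?_)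
      · exact hnear.elim id fun ⟨p, hp, h⟩ => ⟨p, hp, (hiff p hp).2 h⟩
      · exact hnear.elim (fun ⟨p, hp, h⟩ => ⟨p, hp, (hiff p hp).1 h⟩) id
    refine ⟨hP.1.union Nat.one_le_two_pow hQ.1 hPQ, ?_, ?_⟩
    · rintro c ⟨p, hp | hp, hc⟩
      · obtain ⟨d, h⟩ := hP.2.1 c ⟨p, hp, hc⟩
        exact ⟨d, hstep hQ hPQ (Or.inl ⟨p, hp, hc⟩) h⟩
      · obtain ⟨d, h⟩ := hQ.2.1 c ⟨p, hp, hc⟩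
        rw [Set.union_comm]
        exact ⟨d, hstep hP hPQ.symm (Or.inl ⟨p, hp, hc⟩) h⟩
    · rintro d ⟨p, hp | hp, hd⟩
      · obtain ⟨c, h⟩ := hP.2.2 d ⟨p, hp, hd⟩
        exact ⟨c, hstep hQ hPQ (Or.inr ⟨p, hp, hd⟩) h⟩
      · obtain ⟨c, h⟩ := hQ.2.2 d ⟨p, hp, hd⟩
        rw [Set.union_comm]
        exact ⟨c, hstep hP hPQ.symm (Or.inr ⟨p, hp, hd⟩) h⟩

end Game

/-! ### From the local game to first-order sentences -/

section Global

variable {L : FirstOrder.Language.{u, v}} {ι : Type} {X Y : Type w} [L.Structure X] [L.Structure Y]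
  {s : ι → X} {t : ι → Y}

/-- The quantifier rank of a formula. -/
def quantifierRank {α : Type*} : ∀ {n : ℕ}, L.BoundedFormula α n → ℕ
  | _, .falsum => 0
  | _, .equal _ _ => 0
  | _, .rel _ _ => 0
  | _, .imp φ ψ => max (quantifierRank φ) (quantifierRank ψ)
  | _, .all φ => quantifierRank φ + 1

theorem IsPartialIso.empty {r : ℕ} {P : Set (X × Y)} (h : IsPartialIso L s t r P) :
    IsPartialIso L s t 0 ∅ := by
  have hsub : ∅ ∪ constantPairs s t ⊆ P ∪ constantPairs s t :=
    Set.union_subset_union_left _ (Set.empty_subset _)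
  exact ⟨fun p hp p' hp' => h.1 p (hsub hp) p' (hsub hp'),
    fun k R x hx => h.2.1 k R x fun i => hsub (hx i), fun p hp => hp.elim⟩

theorem LocallyEquiv.insert_far {j : ℕ} {P : Set (X × Y)} (h : LocallyEquiv L s t (j + 1) P)
    {c : X} {d : Y} (hcd : LocallyEquiv L s t j {(c, d)})
    (hc : ∀ p ∈ P, ¬ (isolatedGraph L s).edist p.1 c ≤ (2 ^ j : ℕ))
    (hd : ∀ p ∈ P, ¬ (isolatedGraph L t).edist p.2 d ≤ (2 ^ j : ℕ)) :
    LocallyEquiv L s t j (insert (c, d) P) := by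
  rw [Set.insert_eq, Set.union_comm]
  refine h.of_succ.union hcd ?_
  rintro p hp _ rfl
  exact ⟨hc p hp, hd p hp⟩

theorem LocallyEquiv.insert_constant {j : ℕ} {P : Set (X × Y)}
    (h : LocallyEquiv L s t (j + 1) P) (i : ι) :
    LocallyEquiv L s t j (insert (s i, t i) P) := by
  by_cases hi : (s i, t i) ∈ P
  · rw [Set.insert_eq_of_mem hi]
    exact h.of_succ
  have hiff : ∀ p ∈ P, s i = p.1 ↔ t i = p.2 := fun p hp =>
    h.isPartialIso.1 (s i, t i) (Or.inr ⟨i, rfl⟩) p (Or.inl hp)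
  refine h.insert_far (locallyEquiv_of_subset_constantPairs h.isPartialIso.empty j
    (Set.singleton_subset_iff.2 ⟨i, rfl⟩)) (fun p hp hd => hi ?_) (fun p hp hd => hi ?_)
  · rw [SimpleGraph.edist_comm, edist_constant_le_iff] at hd
    rwa [hd, (hiff p hp).1 hd]
  · rw [SimpleGraph.edist_comm, edist_constant_le_iff] at hd
    rwa [hd, (hiff p hp).2 hd]

/-- Every element of `X` which is not a constant has the same local types of rank below `q` as
some element of `Y` in a connected component avoiding any given tuple of length less than `q`,
after the constants are deleted. -/
def HasFarRealizations (L : FirstOrder.Language.{u, v}) {X Y : Type w} [L.Structure X]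
    [L.Structure Y] (s : ι → X) (t : ι → Y) (q : ℕ) : Prop :=
  ∀ n < q, ∀ b : Fin n → Y, ∀ c ∉ Set.range s, ∃ d : Y,
    (∀ i, ∀ e : ℕ, ¬ (isolatedGraph L t).edist (b i) d ≤ e) ∧
    ∀ j < q, localType (L := L) s j (fun _ : Fin 1 => c) = localType t j fun _ : Fin 1 => d

theorem locallyEquiv_singleton {j : ℕ} {c : X} {d : Y}
    (h : localType (L := L) s j (fun _ : Fin 1 => c) = localType t j fun _ : Fin 1 => d) :
    LocallyEquiv L s t j {(c, d)} := by
  simpa using locallyEquiv_of_localType_eq h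

/-- If far realizations exist in both directions, Duplicator can maintain a winning position of
the local game in the usual Ehrenfeucht–Fraïssé game. -/
theorem realize_iff_of_locallyEquiv [L.IsRelational] {q : ℕ} (hst : HasFarRealizations L s t q)
    (hts : HasFarRealizations L t s q) {n j : ℕ} (φ : L.BoundedFormula Empty n)
    (hφ : quantifierRank φ ≤ j) (hj : n + j ≤ q) (a : Fin n → X) (b : Fin n → Y)
    (h : LocallyEquiv L s t j (Set.range fun i => (a i, b i))) (x : Empty → X) (y : Empty → Y) :
    φ.Realize x a ↔ φ.Realize y b := by
  have hterm : ∀ {n : ℕ} (τ : L.Term (Empty ⊕ Fin n)), ∃ i, τ = Term.var (Sum.inr i) := by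
    intro n τ
    match τ with
    | .var (.inl e) => exact e.elim
    | .var (.inr i) => exact ⟨i, rfl⟩
    | .func f _ => exact isEmptyElim f
  induction φ generalizing j with
  | falsum => exact Iff.rfl
  | equal τ₁ τ₂ =>
    obtain ⟨i₁, rfl⟩ := hterm τ₁
    obtain ⟨i₂, rfl⟩ := hterm τ₂
    exact h.isPartialIso.1 (a i₁, b i₁) (Or.inl ⟨i₁, rfl⟩) (a i₂, b i₂) (Or.inl ⟨i₂, rfl⟩)
  | rel R ts =>
    choose i hi using fun k => hterm (ts k)
    obtain rfl : ts = fun k => Term.var (Sum.inr (i k)) := funext hi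
    exact h.isPartialIso.2.1 _ R (fun k => (a (i k), b (i k))) fun k => Or.inl ⟨i k, rfl⟩
  | imp φ ψ ih₁ ih₂ =>
    simp only [quantifierRank, max_le_iff] at hφ
    simp only [BoundedFormula.realize_imp]
    exact imp_congr (ih₁ hφ.1 hj a b h) (ih₂ hφ.2 hj a b h)
  | @all n φ ih =>
    obtain _ | j := j
    · simp [quantifierRank] at hφ
    simp only [quantifierRank, add_le_add_iff_right] at hφ
    have ih' : ∀ c d, LocallyEquiv L s t j (insert (c, d) (Set.range fun i => (a i, b i))) →
        (φ.Realize x (Fin.snoc a c) ↔ φ.Realize y (Fin.snoc b d)) := by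
      intro c d hcd
      refine ih hφ (by omega) _ _ ?_
      rwa [range_prodMk_snoc]
    have hn : n < q := by omega
    have hjq : j < q := by omega
    have hforth : ∀ c, ∃ d,
        LocallyEquiv L s t j (insert (c, d) (Set.range fun i => (a i, b i))) := by
      intro c
      by_cases hcs : c ∈ Set.range s
      · obtain ⟨i, rfl⟩ := hcs
        exact ⟨t i, h.insert_constant i⟩
      by_cases hnear : ∃ p ∈ Set.range fun i => (a i, b i),
          (isolatedGraph L s).edist p.1 c ≤ (2 ^ j : ℕ)
      · exact h.2.1 c hnear
      obtain ⟨d, hfar, htype⟩ := hst n hn b c hcs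
      refine ⟨d, h.insert_far (locallyEquiv_singleton (htype j hjq))
        (fun p hp hd => hnear ⟨p, hp, hd⟩) ?_⟩
      rintro _ ⟨i, rfl⟩
      exact hfar i _
    have hback : ∀ d, ∃ c,
        LocallyEquiv L s t j (insert (c, d) (Set.range fun i => (a i, b i))) := by
      intro d
      by_cases hdt : d ∈ Set.range t
      · obtain ⟨i, rfl⟩ := hdt
        exact ⟨s i, h.insert_constant i⟩
      by_cases hnear : ∃ p ∈ Set.range fun i => (a i, b i),
          (isolatedGraph L t).edist p.2 d ≤ (2 ^ j : ℕ)
      · exact h.2.2 d hnear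
      obtain ⟨c, hfar, htype⟩ := hts n hn a d hdt
      refine ⟨c, h.insert_far (locallyEquiv_singleton (htype j hjq).symm) ?_
        (fun p hp hd => hnear ⟨p, hp, hd⟩)⟩
      rintro _ ⟨i, rfl⟩
      exact hfar i _
    simp only [BoundedFormula.realize_all]
    constructor
    · intro hX d
      obtain ⟨c, hc⟩ := hback d
      exact (ih' c d hc).1 (hX c)
    · intro hY c
      obtain ⟨d, hd⟩ := hforth c
      exact (ih' c d hd).2 (hY d)

theorem realize_sentence_iff [L.IsRelational] (φ : L.Sentence) (h : IsPartialIso L s t 0 ∅)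
    (hst : HasFarRealizations L s t (quantifierRank φ))
    (hts : HasFarRealizations L t s (quantifierRank φ)) : X ⊨ φ ↔ Y ⊨ φ := by
  refine realize_iff_of_locallyEquiv hst hts (j := quantifierRank φ) φ le_rfl (by simp) default
    default ?_ default default
  rw [Set.range_eq_empty]
  exact locallyEquiv_of_subset_constantPairs h _ (Set.empty_subset _)

end Global

/-! ### Canonical existential-positive sentences -/

section Canonical

variable {L : FirstOrder.Language.{u, v}}

theorem IsExistentialPositive.iSup {α β : Type*} [Finite β] {n : ℕ} {φ : β → L.BoundedFormula α n}
    (h : ∀ b, IsExistentialPositive (φ b)) : IsExistentialPositive (BoundedFormula.iSup φ) := by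
  change IsExistentialPositive
    (((@Finset.univ β (Fintype.ofFinite β)).toList.map φ).foldr (· ⊔ ·) ⊥)
  generalize (@Finset.univ β (Fintype.ofFinite β)).toList = l
  induction l with
  | nil => exact .falsum
  | cons b l ih => exact .or (h b) ih

theorem IsExistentialPositive.iInf {α β : Type*} [Finite β] {n : ℕ} {φ : β → L.BoundedFormula α n}
    (h : ∀ b, IsExistentialPositive (φ b)) : IsExistentialPositive (BoundedFormula.iInf φ) := by
  change IsExistentialPositive
    (((@Finset.univ β (Fintype.ofFinite β)).toList.map φ).foldr (· ⊓ ·) ⊤)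
  generalize (@Finset.univ β (Fintype.ofFinite β)).toList = l
  induction l with
  | nil => exact .verum
  | cons b l ih => exact .and (h b) ih

theorem IsExistentialPositive.exs {α : Type*} {n : ℕ} {φ : L.BoundedFormula α n}
    (h : IsExistentialPositive φ) : IsExistentialPositive φ.exs := by
  induction n with
  | zero => exact h
  | succ n ih => exact ih h.ex

/-- The set of relational atoms, with variables indexed by `Fin n`. -/
abbrev RelAtom (L : FirstOrder.Language.{u, v}) (n : ℕ) : Type v :=
  Σ R : (Σ k, L.Relations k), (Fin R.1 → Fin n)

theorem finite_relAtom [Finite L.Symbols] (n : ℕ) : Finite (RelAtom L n) := by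
  have : Finite (Σ k, L.Relations k) :=
    Finite.of_injective (Sum.inr : _ → L.Symbols) Sum.inr_injective
  infer_instance

/-- For a set `D` of relational atoms in `n` variables, there is an existential-positive sentence
saying that all atoms in `D` can be satisfied simultaneously. -/
theorem exists_isExistentialPositive_of_atoms [Finite L.Symbols] (n : ℕ) (D : Set (RelAtom L n)) :
    ∃ ψ : L.Sentence, IsExistentialPositive ψ ∧ ∀ (M : Type w) [L.Structure M],
      M ⊨ ψ ↔ ∃ x : Fin n → M, ∀ T ∈ D, RelMap T.1.2 fun i => x (T.2 i) := by
  have := finite_relAtom (L := L) n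
  refine ⟨(BoundedFormula.iInf fun T : D =>
      (T.1.1.2.boundedFormula fun i => Term.var (Sum.inr (T.1.2 i)))).exs, ?_, ?_⟩
  · exact (IsExistentialPositive.iInf fun T => .rel _ _).exs
  · intro M _
    simp only [Sentence.Realize, BoundedFormula.realize_exs, BoundedFormula.realize_iInf,
      BoundedFormula.realize_rel, Term.realize_var, Sum.elim_inr, Subtype.forall]

/-- If every model in `C` of a sentence preserved by homomorphisms admits a homomorphism from a
model in `C` of bounded size, then the sentence is equivalent to the disjunction of the canonical
existential-positive sentences of the models of bounded size. -/
theorem exists_isExistentialPositive_of_bounded [L.IsRelational] [Finite L.Symbols]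
    (C : Set (Bundled.{w} L.Structure)) (hfin : ∀ M ∈ C, Finite M) (φ : L.Sentence)
    (hφ : PreservedByHoms C φ) (b : ℕ)
    (hb : ∀ M ∈ C, M ⊨ φ → ∃ N ∈ C, N ⊨ φ ∧ Nat.card N < b ∧ Nonempty (N →[L] M)) :
    ∃ ψ : L.Sentence, IsExistentialPositive ψ ∧ ∀ M ∈ C, (M ⊨ φ ↔ M ⊨ ψ) := by
  have := fun n => finite_relAtom (L := L) n
  choose ψ hψ hψM using fun n => exists_isExistentialPositive_of_atoms.{u, v, w} (L := L) n
  let I := {z : Σ n : Fin b, Set (RelAtom L n) // ∃ N ∈ C, N ⊨ φ ∧ ∃ e : Fin z.1 ≃ N,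
    ∀ T, T ∈ z.2 ↔ RelMap T.1.2 fun i => e (T.2 i)}
  refine ⟨BoundedFormula.iSup fun z : I => ψ z.1.1 z.1.2, .iSup fun z => hψ _ _, fun M hM => ?_⟩
  have hsup : M ⊨ (BoundedFormula.iSup fun z : I => ψ z.1.1 z.1.2 : L.Sentence) ↔
      ∃ z : I, M ⊨ ψ z.1.1 z.1.2 := BoundedFormula.realize_iSup
  rw [hsup]
  constructor
  · intro hMφ
    obtain ⟨N, hN, hNφ, hcard, ⟨f⟩⟩ := hb M hM hMφ
    have := hfin N hN
    let e : Fin (Nat.card N) ≃ N := (Finite.equivFin N).symm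
    refine ⟨⟨⟨⟨Nat.card N, hcard⟩, {T | RelMap T.1.2 fun i => e (T.2 i)}⟩, N, hN, hNφ, e,
      fun T => Iff.rfl⟩, (hψM _ _ M).2 ⟨fun i => f (e i), fun T hT => f.map_rel _ _ hT⟩⟩
  · rintro ⟨⟨z, N, hN, hNφ, e, he⟩, hz⟩
    obtain ⟨x, hx⟩ := (hψM _ _ M).1 hz
    refine hφ N hN M hM ⟨⟨fun c => x (e.symm c), fun g => isEmptyElim g, ?_⟩⟩ hNφ
    intro k R c hc
    exact hx ⟨⟨k, R⟩, fun i => e.symm (c i)⟩ ((he _).2 (by simpa using hc))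

end Canonical

/-! ### Free amalgams with an element removed from some of the copies -/

section Amalgam

variable {L : FirstOrder.Language.{u, v}} {M : Type w} {S : Set M} {n : ℕ}

theorem FreeAmalgam.mk_eq_mk_iff {i i' : Fin n} {x x' : M} :
    FreeAmalgam.mk S n i x = FreeAmalgam.mk S n i' x' ↔ x = x' ∧ (i = i' ∨ x ∈ S) := by
  have h : FreeAmalgam.mk S n i x = FreeAmalgam.mk S n i' x' ↔
      (i, x) = (i', x') ∨ (x = x' ∧ x ∈ S) := Quotient.eq (r := amalgamSetoid S n)
  rw [h, Prod.mk.injEq]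
  tauto

theorem FreeAmalgam.exists_mk (z : FreeAmalgam S n) : ∃ i x, FreeAmalgam.mk S n i x = z := by
  obtain ⟨⟨i, x⟩, h⟩ := Quotient.exists_rep z
  exact ⟨i, x, h⟩

/-- The folding map from the free amalgam of copies of `M` back to `M`. -/
def FreeAmalgam.fold (S : Set M) (n : ℕ) : FreeAmalgam S n → M :=
  Quotient.lift (fun p : Fin n × M => p.2) (by
    rintro p q (rfl | h)
    · rfl
    · exact h.1)

theorem FreeAmalgam.fold_mk (i : Fin n) (x : M) :
    FreeAmalgam.fold S n (FreeAmalgam.mk S n i x) = x := rfl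

variable [L.IsRelational] [L.Structure M]

theorem FreeAmalgam.relMap_mk_iff {k : ℕ} (R : L.Relations k) (i : Fin n) (x : Fin k → M) :
    RelMap R (fun l => FreeAmalgam.mk S n i (x l)) ↔ RelMap R x := by
  refine ⟨?_, fun h => ⟨i, x, h, rfl⟩⟩
  rintro ⟨i', y, hy, hxy⟩
  obtain rfl : x = y := funext fun l => (FreeAmalgam.mk_eq_mk_iff.1 (congrFun hxy l)).1
  exact hy

/-- The substructure obtained by removing `a` if the proposition `p` holds, and the whole
structure otherwise. -/
def removeIf (L : FirstOrder.Language.{u, v}) {M : Type w} [L.IsRelational] [L.Structure M]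
    (p : Prop) (a : M) : L.Substructure M :=
  ⟨{x | p → x ≠ a}, fun f => isEmptyElim f⟩

/-- The substructure of the free amalgam obtained by removing `a` from the `i`-th copy of `M` for
all `i` such that `D i` holds. -/
def puncturedAmalgam (L : FirstOrder.Language.{u, v}) {M : Type w} [L.IsRelational] [L.Structure M]
    (S : Set M) (a : M) (D : Fin n → Prop) : L.Substructure (FreeAmalgam S n) :=
  ⟨{z | ∀ i, D i → z ≠ FreeAmalgam.mk S n i a}, fun f => isEmptyElim f⟩

variable {a : M} {D : Fin n → Prop}

theorem mk_mem_puncturedAmalgam_iff (ha : a ∉ S) {i : Fin n} {x : M} :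
    FreeAmalgam.mk S n i x ∈ puncturedAmalgam L S a D ↔ x ∈ removeIf L (D i) a := by
  change (∀ i', D i' → FreeAmalgam.mk S n i x ≠ FreeAmalgam.mk S n i' a) ↔ (D i → x ≠ a)
  constructor
  · rintro h hi rfl
    exact h i hi rfl
  · intro h i' hi' heq
    rw [FreeAmalgam.mk_eq_mk_iff] at heq
    obtain ⟨rfl, rfl | hx⟩ := heq
    · exact h hi' rfl
    · exact ha hx

/-- The inclusion of the `i`-th copy into the punctured amalgam. -/
def copyEmbedding (ha : a ∉ S) (D : Fin n → Prop) (i : Fin n) :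
    removeIf L (D i) a ↪[L] puncturedAmalgam L S a D where
  toFun x := ⟨FreeAmalgam.mk S n i x, (mk_mem_puncturedAmalgam_iff ha).2 x.2⟩
  inj' _ _ h := Subtype.ext (FreeAmalgam.mk_eq_mk_iff.1 (congrArg Subtype.val h)).1
  map_fun' f := isEmptyElim f
  map_rel' R x := FreeAmalgam.relMap_mk_iff R i fun l => (x l : M)

theorem nonempty_hom_puncturedAmalgam (ha : a ∉ S) {i : Fin n} (hi : ¬ D i) :
    Nonempty (M →[L] puncturedAmalgam L S a D) :=
  ⟨⟨fun x => ⟨FreeAmalgam.mk S n i x, (mk_mem_puncturedAmalgam_iff ha).2 fun h => (hi h).elim⟩,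
    fun f => isEmptyElim f, fun R x h => (FreeAmalgam.relMap_mk_iff R i x).2 h⟩⟩

theorem nonempty_hom_removeIf (ha : a ∉ S) (hD : ∀ i, D i) :
    Nonempty (puncturedAmalgam L S a D →[L] removeIf L True a) := by
  refine ⟨⟨fun z => ⟨FreeAmalgam.fold S n z, ?_⟩, fun f => isEmptyElim f, ?_⟩⟩
  · obtain ⟨z, hz⟩ := z
    obtain ⟨i, x, rfl⟩ := FreeAmalgam.exists_mk z
    exact fun _ => (mk_mem_puncturedAmalgam_iff ha).1 hz (hD i)
  · rintro k R z ⟨i, x, hx, hz⟩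
    have : x = fun l => FreeAmalgam.fold S n (z l) := funext fun l => by
      rw [congrFun hz l, FreeAmalgam.fold_mk]
    change RelMap R fun l => FreeAmalgam.fold S n (z l)
    rwa [← this]

variable {ι : Type} {s : ι → M}

/-- The constants `s` as elements of the structure in which `a` has possibly been removed. -/
def removeIfConstants (L : FirstOrder.Language.{u, v}) {M : Type w} [L.IsRelational]
    [L.Structure M] {a : M} {s : ι → M} (ha : a ∉ Set.range s) (p : Prop) (k : ι) :
    removeIf L p a :=
  ⟨s k, fun _ h => ha ⟨k, h⟩⟩

/-- The constants `s` as elements of the punctured amalgam. -/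
def puncturedConstants (L : FirstOrder.Language.{u, v}) {M : Type w} [L.IsRelational]
    [L.Structure M] {a : M} {s : ι → M} (ha : a ∉ Set.range s) [NeZero n] (D : Fin n → Prop)
    (k : ι) : puncturedAmalgam L (Set.range s) a D :=
  ⟨FreeAmalgam.mk _ n 0 (s k), (mk_mem_puncturedAmalgam_iff ha).2 fun _ h => ha ⟨k, h⟩⟩

variable [NeZero n]

theorem copyEmbedding_comp_removeIfConstants (ha : a ∉ Set.range s) (i : Fin n) :
    copyEmbedding ha D i ∘ removeIfConstants L ha (D i) = puncturedConstants L ha D :=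
  funext fun k => Subtype.ext <|
    show FreeAmalgam.mk _ n i (s k) = FreeAmalgam.mk _ n 0 (s k) from
      FreeAmalgam.mk_eq_mk_iff.2 ⟨rfl, Or.inr ⟨k, rfl⟩⟩

theorem mem_range_puncturedConstants_iff (ha : a ∉ Set.range s) {i : Fin n}
    {z : puncturedAmalgam L (Set.range s) a D} {x : M} (hz : z.1 = FreeAmalgam.mk _ n i x) :
    z ∈ Set.range (puncturedConstants L ha D) ↔ x ∈ Set.range s := by
  constructor
  · rintro ⟨k, rfl⟩
    exact ⟨k, (FreeAmalgam.mk_eq_mk_iff.1 hz).1⟩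
  · rintro ⟨k, rfl⟩
    have h : FreeAmalgam.mk (Set.range s) n 0 (s k) = FreeAmalgam.mk _ n i (s k) :=
      FreeAmalgam.mk_eq_mk_iff.2 ⟨rfl, Or.inr ⟨k, rfl⟩⟩
    exact ⟨k, Subtype.ext (h.trans hz.symm)⟩

/-- Once the constants are deleted, distinct copies lie in distinct connected components. -/
theorem exists_mk_of_edist_le (ha : a ∉ Set.range s) {i : Fin n}
    {z z' : puncturedAmalgam L (Set.range s) a D} {x : M} (hx : x ∉ Set.range s)
    (hz : z.1 = FreeAmalgam.mk _ n i x) {d : ℕ}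
    (h : (isolatedGraph L (puncturedConstants L ha D)).edist z z' ≤ d) :
    ∃ y ∉ Set.range s, z'.1 = FreeAmalgam.mk _ n i y := by
  refine mem_of_edist_le (G := isolatedGraph L (puncturedConstants L ha D))
    (T := {z | ∃ y ∉ Set.range s, z.1 = FreeAmalgam.mk _ n i y}) ?_
    ⟨x, hx, hz⟩ h
  rintro z ⟨y, hy, hz⟩ _ ⟨⟨-, k, R, t, ⟨i', u, hu, ht⟩, ⟨l, rfl⟩, ⟨l', rfl⟩⟩, -, hzs⟩
  have hl' : (t l').1 = FreeAmalgam.mk _ n i' (u l') := congrFun ht l'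
  have hi : i = i' := by
    rw [congrFun ht l] at hz
    obtain ⟨rfl, h | h⟩ := FreeAmalgam.mk_eq_mk_iff.1 hz
    · exact h.symm
    · exact (hy h).elim
  subst hi
  exact ⟨u l', fun h => hzs ((mem_range_puncturedConstants_iff ha hl').2 h), hl'⟩

theorem localType_copyEmbedding (ha : a ∉ Set.range s) (i : Fin n) {x : removeIf L (D i) a}
    (hx : (x : M) ∉ Set.range s) (j : ℕ) :
    localType (L := L) (puncturedConstants L ha D) j (fun _ : Fin 1 => copyEmbedding ha D i x) =
      localType (removeIfConstants L ha (D i)) j fun _ : Fin 1 => x := by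
  rw [← copyEmbedding_comp_removeIfConstants ha i]
  refine localType_comp (copyEmbedding ha D i) (removeIfConstants L ha (D i)) j
    (fun _ : Fin 1 => x) ?_
  intro _ z hz
  rw [copyEmbedding_comp_removeIfConstants] at hz
  obtain ⟨y, -, hy⟩ := exists_mk_of_edist_le ha hx rfl hz
  exact ⟨⟨y, (mk_mem_puncturedAmalgam_iff ha).1 (hy ▸ z.2)⟩, Subtype.ext hy.symm⟩

/-- If removing `a` from `M` does not lose any local type, then far realizations exist in a
punctured amalgam of sufficiently many copies: one uses a fresh copy. -/
theorem hasFarRealizations_puncturedAmalgam {q : ℕ} (ha : a ∉ Set.range s)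
    (hreal : ∀ p p' : Prop, p' → ∀ x : removeIf L p a, (x : M) ∉ Set.range s →
      ∃ x' : removeIf L p' a, (x' : M) ∉ Set.range s ∧ ∀ j < q,
        localType (L := L) (removeIfConstants L ha p) j (fun _ : Fin 1 => x) =
          localType (removeIfConstants L ha p') j fun _ : Fin 1 => x')
    (D D' : Fin (q + 1) → Prop) (hD' : ∀ i ≠ 0, D' i) :
    HasFarRealizations L (puncturedConstants L ha D) (puncturedConstants L ha D') q := by
  intro m hm b c hc
  obtain ⟨i, x, hix⟩ := FreeAmalgam.exists_mk c.1
  have hx : x ∉ Set.range s := fun h => hc ((mem_range_puncturedConstants_iff ha hix.symm).2 h)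
  have hxD : x ∈ removeIf L (D i) a := (mk_mem_puncturedAmalgam_iff ha).1 (hix ▸ c.2)
  obtain rfl : copyEmbedding ha D i ⟨x, hxD⟩ = c := Subtype.ext hix
  choose κ y hy using fun l => FreeAmalgam.exists_mk (b l).1
  -- The fresh copy is different from the copy with index `0`, which may still contain `a`.
  obtain ⟨l, hl⟩ : ∃ l, l ∉ insert 0 (Finset.univ.image κ) := by
    by_contra! hcon
    have h₁ : (insert 0 (Finset.univ.image κ)).card ≤ m + 1 :=
      (Finset.card_insert_le _ _).trans
        (Nat.succ_le_succ (Finset.card_image_le.trans (by simp)))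
    rw [Finset.eq_univ_iff_forall.2 hcon, Finset.card_univ, Fintype.card_fin] at h₁
    omega
  simp only [Finset.mem_insert, Finset.mem_image, Finset.mem_univ, true_and, not_or,
    not_exists] at hl
  obtain ⟨x', hx', htype⟩ := hreal (D i) (D' l) (hD' l hl.1) ⟨x, hxD⟩ hx
  refine ⟨copyEmbedding ha D' l x', fun k e hd => ?_, fun j hj => ?_⟩
  · rw [SimpleGraph.edist_comm] at hd
    obtain ⟨y', hy's, hy'⟩ := exists_mk_of_edist_le ha hx' rfl hd
    rw [← hy k] at hy'
    obtain ⟨h, h' | h'⟩ := FreeAmalgam.mk_eq_mk_iff.1 hy'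
    · exact hl.2 k h'
    · exact hy's (h ▸ h')
  · rw [localType_copyEmbedding ha i hx, localType_copyEmbedding ha l hx', htype j hj]

theorem isPartialIso_puncturedAmalgam (ha : a ∉ Set.range s) (D D' : Fin n → Prop) :
    IsPartialIso L (puncturedConstants L ha D) (puncturedConstants L ha D') 0 ∅ := by
  simp only [IsPartialIso, Set.empty_union]
  refine ⟨?_, ?_, fun p hp => hp.elim⟩
  · rintro _ ⟨k, rfl⟩ _ ⟨k', rfl⟩
    simp only [puncturedConstants, Subtype.mk.injEq]
  · intro k R x hx
    choose i hi using hx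
    obtain rfl : (fun l => (puncturedConstants L ha D (i l), puncturedConstants L ha D' (i l))) =
        x := funext hi
    exact Iff.rfl

end Amalgam

/-! ### Removing an element from a large model -/

section Removal

variable {L : FirstOrder.Language.{u, v}} {M : Type w} [L.Structure M]

theorem edist_induce_le {ι : Type} {s : ι → M} {S : Set M} (hs : Set.range s = S) {x y : M}
    (hx : x ∉ S) (hy : y ∉ S) {d : ℕ} (h : (isolatedGraph L s).edist x y ≤ d) :
    ((gaifmanGraph L M).induce Sᶜ).edist ⟨x, hx⟩ ⟨y, hy⟩ ≤ d := by
  subst hs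
  obtain ⟨z, hz, h⟩ := exists_edist_le_of_ball_subset_range
    (G := (gaifmanGraph L M).induce (Set.range s)ᶜ) (G' := isolatedGraph L s)
    (f := (Subtype.val : ((Set.range s)ᶜ : Set M) → M)) (x := ⟨x, hx⟩)
    (fun x _ y hxy => ⟨⟨y, hxy.2.2⟩, rfl, hxy.1⟩)
    (fun z hz => by
      rw [Subtype.range_coe]
      exact mem_of_edist_le (G := isolatedGraph L s) (T := (Set.range s)ᶜ)
        (fun _ _ _ h => h.2.2) hx hz) h
  obtain rfl : z = ⟨y, hy⟩ := Subtype.ext hz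
  exact h

/-- An independent set `A` with more elements than there are local types contains an element `a`
which is far from some realization of each local type that is realized outside of the
constants. -/
theorem exists_far_from_types {ι : Type} {s : ι → M} {T : Type*} [Finite T] (τ : M → T) {d : ℕ}
    {A S : Finset M} (hs : Set.range s = S) (hAS : Disjoint A S)
    (hA : IndependentAfterDeleting L M (d + d) A S) (hcard : Nat.card T < A.card) :
    ∃ a ∈ A, ∀ x ∉ Set.range s, ∃ x' ∉ Set.range s, τ x' = τ x ∧
      ¬ (isolatedGraph L s).edist x' a ≤ d := by
  by_contra! hcon
  choose x hx hxa using hcon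
  have hdisj : ∀ b ∈ A, b ∉ (S : Set M) := fun b hb => by
    simpa using Finset.disjoint_left.1 hAS hb
  have hinj : Function.Injective fun a : A => τ (x a a.2) := by
    intro a b hab
    by_contra hne
    refine hA ⟨a, hdisj a a.2⟩ a.2 ⟨b, hdisj b b.2⟩ b.2
      (fun h => hne (Subtype.ext (congrArg (fun z => z.1) h))) ?_
    have h₁ := hxa a a.2 (x a a.2) (hx a a.2) rfl
    have h₂ := hxa b b.2 (x a a.2) (hx a a.2) hab
    rw [SimpleGraph.edist_comm] at h₁
    exact edist_induce_le hs _ _ (edist_le_add h₁ h₂)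
  have := Nat.card_le_card_of_injective _ hinj
  rw [Nat.card_eq_fintype_card, Fintype.card_coe] at this
  omega

/-- Removing from `M` an element far from realizations of all local types does not lose any local
type. -/
theorem exists_localType_removeIf_eq [L.IsRelational] {ι : Type} {s : ι → M} {a : M} {q : ℕ}
    (ha : a ∉ Set.range s)
    (hfar : ∀ x ∉ Set.range s, ∃ x' ∉ Set.range s,
      (∀ j < q, localType (L := L) s j (fun _ : Fin 1 => x') = localType s j fun _ : Fin 1 => x) ∧
        ¬ (isolatedGraph L s).edist x' a ≤ (2 ^ q : ℕ))
    (p p' : Prop) (hp' : p') (x : removeIf L p a) (hx : (x : M) ∉ Set.range s) :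
    ∃ x' : removeIf L p' a, (x' : M) ∉ Set.range s ∧ ∀ j < q,
      localType (L := L) (removeIfConstants L ha p) j (fun _ : Fin 1 => x) =
        localType (removeIfConstants L ha p') j fun _ : Fin 1 => x' := by
  by_cases hp : p
  · obtain rfl : p = p' := propext (iff_of_true hp hp')
    exact ⟨x, hx, fun _ _ => rfl⟩
  have hcomp : ∀ p, (removeIf L p a).subtype ∘ removeIfConstants L ha p = s := fun _ => rfl
  obtain ⟨x', hx's, htype, hx'a⟩ := hfar x hx
  have hne : x' ≠ a := by
    rintro rfl
    simp at hx'a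
  refine ⟨⟨x', fun _ => hne⟩, hx's, fun j hj => ?_⟩
  have h₁ := localType_comp (removeIf L p a).subtype (removeIfConstants L ha p) j
    (fun _ : Fin 1 => x) fun _ y _ => ⟨⟨y, fun h => (hp h).elim⟩, rfl⟩
  have h₂ := localType_comp (removeIf L p' a).subtype (removeIfConstants L ha p') j
    (fun _ : Fin 1 => ⟨x', fun _ => hne⟩) fun _ y hy => by
      refine ⟨⟨y, fun _ hya => hx'a ?_⟩, rfl⟩
      subst hya
      exact hy.trans (by exact_mod_cast Nat.pow_le_pow_right two_pos hj.le)
  rw [hcomp] at h₁ h₂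
  exact h₁.symm.trans ((htype j hj).symm.trans h₂)

end Removal

/-- A bound on the number of combined local types of ranks below `q` of an element, over at most
`k` constants. -/
noncomputable def typeBound (L : FirstOrder.Language.{u, v}) (k q : ℕ) : ℕ :=
  ∑ k' ∈ Finset.range (k + 1), Nat.card ((j : Fin q) → LocalType L (Fin k') j 1)

/-- The substructure of `M` obtained by removing `a`, as a bundled structure. -/
def removeElement {L : FirstOrder.Language.{u, v}} [L.IsRelational] (M : Bundled.{w} L.Structure)
    (a : M) : Bundled.{w} L.Structure :=
  ⟨removeIf L True a, inferInstance⟩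

/-- A model of `φ` with a large independent set stays a model when a suitable element is removed.
If `a` is such an element, let `X` be the amalgam with `a` removed from all copies but one, and
let `Y` be the amalgam with `a` removed from all copies. Then there are homomorphisms from `M` to
`X` and from `Y` to `M` without `a`, while `X` and `Y` agree on sentences of the quantifier rank
of `φ`. -/
theorem exists_removeElement_models {L : FirstOrder.Language.{u, v}} [L.IsRelational]
    [Finite L.Symbols] {C : Set (Bundled.{w} L.Structure)} (hher : IsHereditary C) {φ : L.Sentence}
    (hφ : PreservedByHoms C φ) {k : ℕ} {M : Bundled.{w} L.Structure} (hM : M ∈ C) (hMφ : M ⊨ φ)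
    {A S : Finset M} (hAS : Disjoint A S) (hk : S.card ≤ k)
    (hcard : typeBound L k (quantifierRank φ) + 2 ≤ A.card)
    (hA : IndependentAfterDeleting L M (2 ^ quantifierRank φ + 2 ^ quantifierRank φ) A S)
    (hC : ∀ n : ℕ, 1 ≤ n → amalgam M (S : Set M) n ∈ C) :
    ∃ a : M, removeElement M a ∈ C ∧ removeElement M a ⊨ φ := by
  set q := quantifierRank φ with hq
  let s : Fin S.card → M := fun i => S.equivFin.symm i
  have hs : Set.range s = S := by
    ext x
    constructor
    · rintro ⟨i, rfl⟩
      exact (S.equivFin.symm i).2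
    · intro hx
      exact ⟨S.equivFin ⟨x, hx⟩, by simp [s]⟩
  have hfinite := fun j : Fin q => finite_localType (L := L) (ι := Fin S.card) j 1
  have hbound : Nat.card ((j : Fin q) → LocalType L (Fin S.card) j 1) ≤ typeBound L k q :=
    Finset.single_le_sum
      (f := fun k' => Nat.card ((j : Fin q) → LocalType L (Fin k') j 1))
      (fun _ _ => Nat.zero_le _) (Finset.mem_range.2 (Nat.lt_succ_of_le hk))
  obtain ⟨a, haA, hfar⟩ := exists_far_from_types
    (fun x (j : Fin q) => localType (L := L) s j fun _ : Fin 1 => x) hs hAS hA (by omega)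
  have ha : a ∉ Set.range s := by
    rw [hs]
    simpa using Finset.disjoint_left.1 hAS haA
  have hreal := exists_localType_removeIf_eq (q := q) ha fun x hx => by
    obtain ⟨x', hx', htype, hd⟩ := hfar x hx
    exact ⟨x', hx', fun j hj => congrFun htype ⟨j, hj⟩, hd⟩
  obtain ⟨b, -, hba⟩ : ∃ b ∈ A, b ≠ a := A.exists_mem_ne (by omega) a
  have hW : amalgam M (Set.range s) (q + 1) ∈ C := by
    rw [hs]
    exact hC _ (Nat.le_add_left 1 q)
  have hN : removeElement M a ∈ C :=
    hher M hM _ ⟨⟨b, fun _ => hba⟩⟩ ⟨(removeIf L True a).subtype⟩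
  have hZ : ∀ D : Fin (q + 1) → Prop,
      (⟨puncturedAmalgam L (Set.range s) a D, inferInstance⟩ : Bundled.{w} L.Structure) ∈ C :=
    fun D => hher _ hW _
      ⟨⟨FreeAmalgam.mk _ _ 0 b, (mk_mem_puncturedAmalgam_iff ha).2 fun _ => hba⟩⟩
      ⟨(puncturedAmalgam L (Set.range s) a D).subtype⟩
  have hX := hφ M hM _ (hZ fun i => i ≠ 0)
    (nonempty_hom_puncturedAmalgam ha (i := 0) (by simp)) hMφ
  have hXY := realize_sentence_iff φ
    (isPartialIso_puncturedAmalgam (L := L) ha (fun i : Fin (q + 1) => i ≠ 0) fun _ => True)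
    (hasFarRealizations_puncturedAmalgam ha hreal _ _ fun _ _ => trivial)
    (hasFarRealizations_puncturedAmalgam ha hreal _ _ fun _ h => h)
  exact ⟨a, hN, hφ _ (hZ fun _ => True) _ hN (nonempty_hom_removeIf ha fun _ => trivial)
    (hXY.1 hX)⟩

end HomPreservation

theorem mainTheorem1
    {L : FirstOrder.Language.{u, v}} [L.IsRelational] [Finite L.Symbols]
    (C : Set (CategoryTheory.Bundled.{w} L.Structure))
    (hfin : ∀ M ∈ C, Finite M)
    (hher : HomPreservation.IsHereditary C)
    (hC : ∀ r : ℕ, ∃ (k : ℕ) (f : ℕ → ℕ), ∀ m : ℕ, ∀ M ∈ C, f m ≤ Nat.card M →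
      ∃ A S : Finset M, Disjoint A S ∧ m ≤ A.card ∧ S.card ≤ k ∧
        HomPreservation.IndependentAfterDeleting L M r (A : Set M) (S : Set M) ∧
        ∀ n : ℕ, 1 ≤ n → HomPreservation.amalgam M (S : Set M) n ∈ C) :
    HomPreservation.HasHomPreservation C := by
  open HomPreservation in
  intro φ hφ
  obtain ⟨k, f, hf⟩ := hC (2 ^ quantifierRank φ + 2 ^ quantifierRank φ)
  refine exists_isExistentialPositive_of_bounded C hfin φ hφ
    (f (typeBound L k (quantifierRank φ) + 2)) fun M hM hMφ => ?_
  induction hc : Nat.card M using Nat.strong_induction_on generalizing M with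
  | _ c ih =>
    subst hc
    rcases lt_or_ge (Nat.card M) (f (typeBound L k (quantifierRank φ) + 2)) with hlt | hge
    · exact ⟨M, hM, hMφ, hlt, ⟨FirstOrder.Language.Hom.id L M⟩⟩
    obtain ⟨A, S, hAS, hA, hS, hind, ham⟩ := hf _ M hM hge
    obtain ⟨a, ha, haφ⟩ := exists_removeElement_models hher hφ hM hMφ hAS hS hA hind ham
    have := hfin M hM
    have hcard : Nat.card (removeElement M a) < Nat.card M :=
      Finite.card_subtype_lt (p := fun x => True → x ≠ a) (x := a) (by simp)
    obtain ⟨N, hN, hNφ, hNc, ⟨g⟩⟩ := ih _ hcard _ ha haφ rfl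
    exact ⟨N, hN, hNφ, hNc, ⟨(removeIf L True a).subtype.toHom.comp g⟩⟩
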